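/- Let $G$ be a finite group. A finite $G$-simplicial complex is a finite simplicial complex $\mathcal K$ with an action of $G$ on its vertices that sends simplices to simplices; it is called free if $G$ acts freely on its geometric realization, which is also denoted $\mathcal K$. For $k\ge 0$ let $E_kG=G^{*(k+1)}$ be the $(k+1)$-fold join of the discrete space $G$ with its natural $G$-action. The mapping index $\operatorname{ind}X$ of a $G$-space $X$ is the least integer $k\ge 0$ for which there is a continuous $G$-equivariant map $X\to E_kG$ (and $\infty$ if there is none). A $G$-poset is a partially ordered set with an order preserving action of $G$. For $n\ge 0$ let $Q_nG$ be the $G$-poset $G\times\{0,\dots,n\}$ with $g\cdot(h,i)=(gh,i)$ and with $(g,i)\prec(h,j)$ if and only if $i<j$. The cross-index $\operatorname{xind}P$ of a $G$-poset $P$ is the least integer $n\ge 0$ for which there is an order preserving $G$-equivariant map $P\to Q_nG$ (and $\infty$ if there is none). The face poset $\mathcal F(\mathcal K)$ consists of the non-empty simplices of $\mathcal K$, ordered by inclusion, with the induced action of $G$. Products of $G$-spaces carry the diagonal action; products of $G$-posets carry the diagonal action and the componentwise order. For an integer $n\ge 0$ consider the following two statements. $\mathsf{HCX}_n(G)$: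 for all finite free $G$-simplicial complexes $\mathcal K_1,\mathcal K_2$, if $\operatorname{xind}\mathcal F(\mathcal K_1)=\operatorname{xind}\mathcal F(\mathcal K_2)=n$, then $\operatorname{xind}\bigl(\mathcal F(\mathcal K_1)\times\mathcal F(\mathcal K_2)\bigr)=n$. $\mathsf{HCT}_n(G)$: for all finite free $G$-simplicial complexes $\mathcal K_1,\mathcal K_2$, if $\operatorname{ind}\mathcal K_1=\operatorname{ind}\mathcal K_2=n$, then $\operatorname{ind}(\mathcal K_1\times\mathcal K_2)=n$. Theorem. For every finite group $G$ and every integer $n\ge 0$, $\mathsf{HCX}_n(G)$ implies $\mathsf{HCT}_n(G)$. -/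

import Mathlib

universe u v

noncomputable section

namespace EquivariantIndex

/-- A `G`-simplicial complex with vertex set `V`: an abstract simplicial complex on `V`, all points
of `V` being vertices, together with an action of `G` on `V` that sends faces to faces. -/
structure GComplex (G : Type v) [Group G] (V : Type u) [MulAction G V] extends
    AbstractSimplicialComplex V where
  /-- the translate of a face is a face -/
  smul_mem : ∀ (g : G), ∀ s ∈ faces, s.map (MulAction.toPerm g).toEmbedding ∈ faces

namespace GComplex

variable {G : Type v} [Group G] {V : Type u} [MulAction G V]

/-- The face poset of a complex: its (non-empty) simplices, ordered by inclusion. -/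
def FacePoset (K : GComplex G V) : Type u := {s : Finset V // s ∈ K.faces}

instance (K : GComplex G V) : PartialOrder K.FacePoset :=
  inferInstanceAs (PartialOrder {s : Finset V // s ∈ K.faces})

instance (K : GComplex G V) : MulAction G K.FacePoset where
  smul g s := ⟨s.1.map (MulAction.toPerm g).toEmbedding, K.smul_mem g s.1 s.2⟩
  one_smul s := Subtype.ext <| Finset.ext fun v => by
    change v ∈ s.1.map _ ↔ _
    simp
  mul_smul g h s := Subtype.ext <| Finset.ext fun v => by
    change v ∈ s.1.map _ ↔ v ∈ (s.1.map _).map _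
    simp [mul_smul]

instance (K : GComplex G V) : CovariantClass G K.FacePoset (· • ·) (· ≤ ·) where
  elim _ _ _ h := Finset.map_subset_map.2 h

/-- The geometric realization of a finite complex: the barycentric coordinate functions on the
vertex set that vanish outside some face, with the topology of `V → ℝ`. -/
def Realization [Fintype V] (K : GComplex G V) : Type u :=
  {x : V → ℝ // x ∈ stdSimplex ℝ V ∧ ∃ s ∈ K.faces, ∀ v, v ∉ s → x v = 0}

instance [Fintype V] (K : GComplex G V) : TopologicalSpace K.Realization :=
  inferInstanceAs (TopologicalSpace
    {x : V → ℝ // x ∈ stdSimplex ℝ V ∧ ∃ s ∈ K.faces, ∀ v, v ∉ s → x v = 0})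

/-- The action of `G` on the realization: the affine extension of the action on vertices. -/
instance [Fintype V] (K : GComplex G V) : MulAction G K.Realization where
  smul g x := ⟨fun v => x.1 (g⁻¹ • v), ⟨fun v => x.2.1.1 _, by
      rw [← x.2.1.2]
      exact Equiv.sum_comp (MulAction.toPerm g⁻¹) x.1⟩, by
    obtain ⟨s, hs, hx⟩ := x.2.2
    refine ⟨_, K.smul_mem g s hs, fun v hv => hx _ fun hvs => hv ?_⟩
    exact Finset.mem_map.2 ⟨_, hvs, by simp⟩⟩
  one_smul x := Subtype.ext <| funext fun v => by
    change x.1 ((1 : G)⁻¹ • v) = x.1 v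
    simp
  mul_smul g h x := Subtype.ext <| funext fun v => by
    change x.1 ((g * h)⁻¹ • v) = x.1 (h⁻¹ • g⁻¹ • v)
    simp [mul_smul]

instance [Fintype V] (K : GComplex G V) : ContinuousConstSMul G K.Realization where
  continuous_const_smul g :=
    continuous_induced_rng.2 (continuous_pi fun v =>
      (continuous_apply (g⁻¹ • v)).comp continuous_induced_dom)

/-- A `G`-simplicial complex is free if `G` acts freely on its geometric realization. -/
def IsFree [Fintype V] (K : GComplex G V) : Prop := IsCancelSMul G K.Realization

end GComplex

/-- The identifications in the `(k+1)`-fold join of `G` with itself: `(t, x)` stands for the formal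
convex combination `t₀ x₀ + ⋯ + tₖ xₖ`, in which terms with coefficient `0` are disregarded. -/
def joinSetoid (G : Type v) (k : ℕ) :
    Setoid (stdSimplex ℝ (Fin (k + 1)) × (Fin (k + 1) → G)) where
  r p q := p.1 = q.1 ∧ ∀ i, p.1.1 i ≠ 0 → p.2 i = q.2 i
  iseqv :=
    { refl := fun _ => ⟨rfl, fun _ _ => rfl⟩
      symm := fun h => ⟨h.1.symm, fun i hi => (h.2 i (h.1 ▸ hi)).symm⟩
      trans := fun h h' => ⟨h.1.trans h'.1, fun i hi => (h.2 i hi).trans (h'.2 i (h.1 ▸ hi))⟩ }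

/-- The space `E_k G`: the `(k+1)`-fold join of the discrete space `G`. -/
def EG (G : Type v) (k : ℕ) : Type v := Quotient (joinSetoid G k)

/-- The quotient topology, where `G` is discrete. -/
instance (G : Type v) (k : ℕ) : TopologicalSpace (EG G k) :=
  letI : TopologicalSpace G := ⊥
  inferInstanceAs (TopologicalSpace (Quotient (joinSetoid G k)))

/-- The action `g • (t₀ x₀ + ⋯ + tₖ xₖ) = t₀ (g x₀) + ⋯ + tₖ (g xₖ)`. -/
instance (G : Type v) [Group G] (k : ℕ) : MulAction G (EG G k) where
  smul g := Quotient.map (fun p => (p.1, fun i => g * p.2 i))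
    fun _ _ h => ⟨h.1, fun i hi => congrArg (g * ·) (h.2 i hi)⟩
  one_smul x := by
    induction x using Quotient.inductionOn with
    | h p => exact congrArg (Quotient.mk _) (Prod.ext rfl (funext fun i => one_mul _))
  mul_smul g h x := by
    induction x using Quotient.inductionOn with
    | h p => exact congrArg (Quotient.mk _) (Prod.ext rfl (funext fun i => mul_assoc _ _ _))

instance (G : Type v) [Group G] (k : ℕ) : ContinuousConstSMul G (EG G k) where
  continuous_const_smul g := by
    let : TopologicalSpace G := ⊥
    have : DiscreteTopology G := ⟨rfl⟩
    refine continuous_quot_lift _ (continuous_quotient_mk'.comp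
      (continuous_fst.prodMk (continuous_pi fun i => ?_)))
    exact (continuous_of_discreteTopology (f := fun x : G => g * x)).comp
      ((continuous_apply i).comp continuous_snd)

/-- The mapping index of a `G`-space `X`: the least `k` for which there is a continuous
`G`-equivariant map `X → E_k G` (and `⊤` if there is none). -/
def mappingIndex (G : Type v) [Group G] (X : Type*) [TopologicalSpace X] [MulAction G X]
    [ContinuousConstSMul G X] : ℕ∞ :=
  ⨅ (k : ℕ) (_ : ∃ f : X →[G] EG G k, Continuous f), (k : ℕ∞)

/-- The ground set `G × {0, …, n}` of the poset `Q_n G`. -/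
@[ext]
structure QPoset (G : Type v) (n : ℕ) where
  /-- the component in `G` -/
  elt : G
  /-- the component in `{0, …, n}` -/
  level : Fin (n + 1)

/-- The order of `Q_n G`: `(g, i) < (h, j)` if and only if `i < j`. -/
instance (G : Type v) (n : ℕ) : PartialOrder (QPoset G n) where
  le p q := p = q ∨ p.level < q.level
  lt p q := p.level < q.level
  le_refl _ := Or.inl rfl
  le_trans := by
    rintro _ _ _ (rfl | h) (rfl | h')
    · exact Or.inl rfl
    · exact Or.inr h'
    · exact Or.inr h
    · exact Or.inr (h.trans h')
  le_antisymm := by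
    rintro p q (rfl | h) (h' | h')
    · rfl
    · rfl
    · exact h'.symm
    · exact absurd h' h.asymm
  lt_iff_le_not_ge p q := by
    constructor
    · intro h
      refine ⟨Or.inr h, ?_⟩
      rintro (rfl | h')
      · exact lt_irrefl _ h
      · exact h.asymm h'
    · rintro ⟨rfl | h, h'⟩
      · exact absurd (Or.inl rfl) h'
      · exact h

instance (G : Type v) [Group G] (n : ℕ) : MulAction G (QPoset G n) where
  smul g p := ⟨g * p.elt, p.level⟩
  one_smul _ := QPoset.ext (one_mul _) rfl
  mul_smul _ _ _ := QPoset.ext (mul_assoc _ _ _) rfl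

instance (G : Type v) [Group G] (n : ℕ) : CovariantClass G (QPoset G n) (· • ·) (· ≤ ·) where
  elim g _ _ h := h.imp (congrArg (g • ·)) id

instance {G : Type v} [Group G] {P Q : Type*} [PartialOrder P] [PartialOrder Q] [MulAction G P]
    [MulAction G Q] [CovariantClass G P (· • ·) (· ≤ ·)] [CovariantClass G Q (· • ·) (· ≤ ·)] :
    CovariantClass G (P × Q) (· • ·) (· ≤ ·) where
  elim g _ _ h := ⟨smul_mono_right g h.1, smul_mono_right g h.2⟩

/-- The cross-index of a `G`-poset `P`: the least `n` for which there is an order preserving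
`G`-equivariant map `P → Q_n G` (and `⊤` if there is none). -/
def crossIndex (G : Type v) [Group G] (P : Type*) [PartialOrder P] [MulAction G P]
    [CovariantClass G P (· • ·) (· ≤ ·)] : ℕ∞ :=
  ⨅ (n : ℕ) (_ : ∃ f : P →[G] QPoset G n, Monotone f), (n : ℕ∞)

/-- The statement `HCT_n(G)`: if two finite free `G`-simplicial complexes have mapping index `n`,
then so has the product of their realizations, with the diagonal action. -/
def HCT (G : Type v) [Group G] (n : ℕ) : Prop :=
  ∀ (V₁ V₂ : Type u) [Fintype V₁] [Fintype V₂] [MulAction G V₁] [MulAction G V₂]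
    (K₁ : GComplex G V₁) (K₂ : GComplex G V₂), K₁.IsFree → K₂.IsFree →
    mappingIndex G K₁.Realization = n → mappingIndex G K₂.Realization = n →
    mappingIndex G (K₁.Realization × K₂.Realization) = n

/-- The statement `HCX_n(G)`: if the face posets of two finite free `G`-simplicial complexes have
cross-index `n`, then so has the product of these posets, with the diagonal action. -/
def HCX (G : Type v) [Group G] (n : ℕ) : Prop :=
  ∀ (V₁ V₂ : Type u) [Fintype V₁] [Fintype V₂] [MulAction G V₁] [MulAction G V₂]
    (K₁ : GComplex G V₁) (K₂ : GComplex G V₂), K₁.IsFree → K₂.IsFree →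
    crossIndex G K₁.FacePoset = n → crossIndex G K₂.FacePoset = n →
    crossIndex G (K₁.FacePoset × K₂.FacePoset) = n

end EquivariantIndex

end

/-! Cross-index and mapping index agree after a fine enough approximation. A monotone equivariant
map `F(L) → Q_m G` always induces `|L| → E_m G` (`GComplex.exists_map_EG`). Conversely, an
equivariant map to `E_k G` whose coordinates vary by less than `1/(k+1)` on each cell induces a
monotone map to `Q_k G` (`exists_map_QPoset_of_small`); this works for face posets and for their
products alike.

Instead of iterated subdivisions of `K`, the proof uses nerves `L` of fine covers, with equivariant
maps `r : |K| → |L|` and `π : |L| → |K|`, where `π` sends cells to small sets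
(`exists_fine_complex`). If `ind K = n`, both conversions give `xind F(L) = n`, and `π` makes `L`
free.

The bound `ind (K₁ × K₂) ≤ n` comes from a projection. Given `f : K₁ × K₂ → E_k G`, choose `Lᵢ` so
fine that `f ∘ (π₁ × π₂)` varies little on products of cells. It then yields `F(L₁) × F(L₂) → Q_k
G`, and the hypothesis on cross-indices forces `n ≤ k`. -/

namespace EquivariantIndex

/-! ### Coordinates on the join, and maps into and out of it -/

section Join

variable {G : Type v} {k : ℕ}

open Classical in
/-- The barycentric coordinates on the join `E_k G`, indexed by `G × {0, …, k}`. -/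
noncomputable def EG.coord (y : EG G k) : G → Fin (k + 1) → ℝ :=
  Quotient.lift (fun p : stdSimplex ℝ (Fin (k + 1)) × (Fin (k + 1) → G) =>
    fun g i => if p.2 i = g then p.1.1 i else 0) (by
      rintro ⟨t, x⟩ ⟨t', x'⟩ ⟨h, h'⟩
      obtain rfl : t = t' := h
      funext g i
      by_cases hi : t.1 i = 0
      · simp [hi]
      · simp [show x i = x' i from h' i hi]) y

open Classical in
theorem EG.coord_mk (p : stdSimplex ℝ (Fin (k + 1)) × (Fin (k + 1) → G)) (g : G)
    (i : Fin (k + 1)) :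
    EG.coord (Quotient.mk (joinSetoid G k) p) g i = if p.2 i = g then p.1.1 i else 0 := rfl

open Classical in
theorem EG.coord_smul [Group G] (g : G) (y : EG G k) (h : G) (i : Fin (k + 1)) :
    (g • y).coord (g * h) i = y.coord h i := by
  induction y using Quotient.inductionOn with
  | h p =>
    change EG.coord (Quotient.mk (joinSetoid G k) (p.1, fun i => g * p.2 i)) (g * h) i = _
    rw [EG.coord_mk, EG.coord_mk]
    exact if_congr (mul_right_inj (b := p.2 i) g) rfl rfl

theorem EG.coord_eq_zero (y : EG G k) {g h : G} {i : Fin (k + 1)} (hg : y.coord g i ≠ 0)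
    (hgh : g ≠ h) : y.coord h i = 0 := by
  induction y using Quotient.inductionOn with
  | h p =>
    rw [EG.coord_mk] at hg ⊢
    exact if_neg fun hh => hg (if_neg fun hg' => hgh (hg'.symm.trans hh))

theorem EG.exists_le_coord (y : EG G k) : ∃ g i, 1 / ((k : ℝ) + 1) ≤ y.coord g i := by
  induction y using Quotient.inductionOn with
  | h p =>
    obtain ⟨i, -, hi⟩ : ∃ i ∈ (Finset.univ : Finset (Fin (k + 1))),
        1 / ((k : ℝ) + 1) ≤ p.1.1 i := by
      refine Finset.exists_le_of_sum_le Finset.univ_nonempty ?_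
      rw [p.1.2.2]
      simp only [Finset.sum_const, Finset.card_univ, Fintype.card_fin, nsmul_eq_mul]
      push_cast
      rw [mul_one_div_cancel (by positivity)]
    exact ⟨p.2 i, i, by simpa [EG.coord_mk] using hi⟩

theorem EG.sum_coord [Fintype G] (p : stdSimplex ℝ (Fin (k + 1)) × (Fin (k + 1) → G))
    (i : Fin (k + 1)) :
    ∑ g, EG.coord (Quotient.mk (joinSetoid G k) p) g i = p.1.1 i := by
  classical
  simp [EG.coord_mk]

/-- Summing over `G` recovers each `tᵢ`; where `tᵢ ≠ 0`, the only nonzero entry on level `i` sits at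
`xᵢ`. -/
theorem EG.coord_injective [Finite G] : Function.Injective (EG.coord : EG G k → _) := by
  have := Fintype.ofFinite G
  intro y y' h
  induction y using Quotient.inductionOn with
  | h p =>
  induction y' using Quotient.inductionOn with
  | h q =>
    have hpq : p.1 = q.1 := by
      refine Subtype.ext (funext fun i => ?_)
      rw [← EG.sum_coord p i, ← EG.sum_coord q i, h]
    refine Quotient.sound ⟨hpq, fun i hi => ?_⟩
    have := congrFun (congrFun h (p.2 i)) i
    rw [EG.coord_mk, EG.coord_mk, if_pos rfl] at this
    by_contra hne
    rw [if_neg (Ne.symm hne)] at this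
    exact hi this

theorem EG.continuous_coord : Continuous (EG.coord : EG G k → _) := by
  let : TopologicalSpace G := ⊥
  have : DiscreteTopology G := ⟨rfl⟩
  refine continuous_quot_lift _ (continuous_pi fun g => continuous_pi fun i => ?_)
  classical
  have h1 : Continuous fun x : G => if x = g then (1 : ℝ) else 0 := continuous_of_discreteTopology
  have h2 : Continuous fun p : stdSimplex ℝ (Fin (k + 1)) × (Fin (k + 1) → G) =>
      (if p.2 i = g then (1 : ℝ) else 0) * p.1.1 i :=
    (h1.comp ((continuous_apply i).comp continuous_snd)).mul
      ((continuous_apply i).comp (continuous_subtype_val.comp continuous_fst))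
  convert h2 using 2 with p
  simp

theorem EG.compactSpace [Finite G] : CompactSpace (EG G k) := by
  let : TopologicalSpace G := ⊥
  exact inferInstanceAs (CompactSpace (Quotient (joinSetoid G k)))

/-- A continuous injection from a compact space to a Hausdorff space is an embedding. Continuity of
maps into the quotient can thus be tested on coordinates. -/
theorem EG.isInducing_coord [Finite G] : Topology.IsInducing (EG.coord : EG G k → _) :=
  have := EG.compactSpace (G := G) (k := k)
  (EG.continuous_coord.isClosedEmbedding EG.coord_injective).isInducing

theorem EG.exists_coord_eq [Fintype G] [Nonempty G] (w : G → Fin (k + 1) → ℝ)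
    (hw : ∀ g i, 0 ≤ w g i) (hsum : ∑ i, ∑ g, w g i = 1)
    (huniq : ∀ g h i, w g i ≠ 0 → w h i ≠ 0 → g = h) : ∃ y : EG G k, y.coord = w := by
  -- On a level of total weight zero any group element will do, since the join disregards it.
  have hx : ∀ i, ∃ g, ∀ h, w h i ≠ 0 → g = h := fun i => by
    by_cases hi : ∃ g, w g i ≠ 0
    · exact hi.imp fun g hg h hh => huniq g h i hg hh
    · push Not at hi
      exact ⟨Classical.arbitrary G, fun h hh => absurd (hi h) hh⟩
  choose x hx using hx
  refine ⟨Quotient.mk (joinSetoid G k)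
    (⟨fun i => ∑ g, w g i, fun i => Finset.sum_nonneg fun g _ => hw g i, hsum⟩, x), ?_⟩
  funext g i
  rw [EG.coord_mk]
  dsimp only
  split_ifs with hg
  · refine Finset.sum_eq_single_of_mem g (Finset.mem_univ g) fun h _ hh => ?_
    by_contra h0
    exact hh ((hx i h h0).symm.trans hg)
  · by_contra h0
    exact hg (hx i g (Ne.symm h0))

/-- Equivariant weights that single out at most one group element on each level define an
equivariant map to the join. -/
theorem exists_map_EG_of_weights [Group G] [Finite G] {X : Type*} [TopologicalSpace X]
    [MulAction G X] (w : G → Fin (k + 1) → X → ℝ) (hcont : ∀ g i, Continuous (w g i))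
    (hw : ∀ g i x, 0 ≤ w g i x) (hpos : ∀ x, ∃ g i, w g i x ≠ 0)
    (huniq : ∀ g h i x, w g i x ≠ 0 → w h i x ≠ 0 → g = h)
    (hsmul : ∀ g h i x, w (g * h) i (g • x) = w h i x) :
    ∃ f : X →[G] EG G k, Continuous f := by
  have := Fintype.ofFinite G
  let S : X → ℝ := fun x => ∑ i, ∑ g, w g i x
  have hS : ∀ x, 0 < S x := fun x => by
    obtain ⟨g, i, h⟩ := hpos x
    refine Finset.sum_pos' (fun i _ => Finset.sum_nonneg fun g _ => hw g i x)
      ⟨i, Finset.mem_univ i, Finset.sum_pos' (fun g _ => hw g i x) ⟨g, Finset.mem_univ g, ?_⟩⟩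
    exact (hw g i x).lt_of_ne' h
  have hSg : ∀ (g : G) x, S (g • x) = S x := fun g x => Finset.sum_congr rfl fun i _ => by
    rw [← Equiv.sum_comp (Equiv.mulLeft g)]
    exact Finset.sum_congr rfl fun h _ => hsmul g h i x
  have hf : ∀ x, ∃ y : EG G k, y.coord = fun g i => w g i x / S x := fun x => by
    refine EG.exists_coord_eq _ (fun g i => div_nonneg (hw g i x) (hS x).le) ?_ fun g h i h1 h2 =>
      huniq g h i x (fun h0 => h1 (by simp [h0])) (fun h0 => h2 (by simp [h0]))
    simp_rw [← Finset.sum_div]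
    exact div_self (hS x).ne'
  choose f hf using hf
  refine ⟨⟨f, fun g x => EG.coord_injective ?_⟩, EG.isInducing_coord.continuous_iff.2 ?_⟩
  · funext h i
    have h1 := EG.coord_smul g (f x) (g⁻¹ * h) i
    have h2 := hsmul g (g⁻¹ * h) i x
    rw [mul_inv_cancel_left] at h1 h2
    rw [id, h1, hf, hf]
    simp only [hSg, h2]
  · refine continuous_pi fun g => continuous_pi fun i => ?_
    have : (fun x => (f x).coord g i) = fun x => w g i x / S x :=
      funext fun x => by rw [hf]
    change Continuous fun x => (f x).coord g i
    rw [this]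
    exact (hcont g i).div (continuous_finsetSum _ fun i _ => continuous_finsetSum _ fun g _ =>
      hcont g i) fun x => (hS x).ne'

/-- A map to the join `E_k G` that varies little on the cells of a family indexed by a `G`-poset
yields an order preserving map to `Q_k G`. -/
theorem exists_map_QPoset_of_small [Group G] {X P : Type*}
    [MulAction G X] [PartialOrder P] [MulAction G P] (f : X →[G] EG G k) (C : P → Set X)
    (hne : ∀ c, (C c).Nonempty) (hmono : Monotone C)
    (hsmul : ∀ (g : G) c x, x ∈ C c → g • x ∈ C (g • c))
    (hsmall : ∀ c, ∀ x ∈ C c, ∀ y ∈ C c, ∀ g i,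
      |(f x).coord g i - (f y).coord g i| < 1 / ((k : ℝ) + 1)) :
    ∃ F : P →[G] QPoset G k, Monotone F := by
  -- `S c` collects the pairs whose coordinate reaches the average `1/(k+1)` somewhere on `C c`; `F
  -- c` will be its element of highest level.
  let S : P → Set (QPoset G k) := fun c =>
    {q | ∃ x ∈ C c, 1 / ((k : ℝ) + 1) ≤ (f x).coord q.elt q.level}
  have hk : 0 < 1 / ((k : ℝ) + 1) := by positivity
  -- Where `(h, i)` has a large coordinate, that of `(g, i)` with `g ≠ h` vanishes, so having both
  -- in `S c` would force a variation of at least `1/(k+1)`.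
  have huniq : ∀ c, ∀ p ∈ S c, ∀ q ∈ S c, p.level = q.level → p = q := by
    rintro c ⟨g, i⟩ ⟨x, hx, hgx⟩ ⟨h, j⟩ ⟨y, hy, hhy⟩ hij
    obtain rfl : i = j := hij
    dsimp only at hgx hhy
    by_contra hne
    have h0 := (f y).coord_eq_zero (h := g) (hk.trans_le hhy).ne' (fun h => hne (by rw [h]))
    have := hsmall c x hx y hy g i
    rw [h0, sub_zero] at this
    exact absurd ((le_abs_self _).trans_lt this) (not_lt.2 hgx)
  have hSg : ∀ (g : G) c q, q ∈ S c → g • q ∈ S (g • c) := by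
    rintro g c q ⟨x, hx, hq⟩
    refine ⟨g • x, hsmul g c x hx, ?_⟩
    rw [map_smul]
    exact hq.trans_eq (EG.coord_smul g (f x) q.elt q.level).symm
  have hex : ∀ c, ∃ q ∈ S c, ∀ q' ∈ S c, q'.level ≤ q.level := fun c => by
    obtain ⟨x, hx⟩ := hne c
    obtain ⟨g, i, hgi⟩ := (f x).exists_le_coord
    obtain ⟨i, ⟨q, hq, rfl⟩, hi⟩ := Set.exists_max_image (QPoset.level '' S c) id
      (Set.toFinite _) ⟨i, ⟨g, i⟩, ⟨x, hx, hgi⟩, rfl⟩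
    exact ⟨q, hq, fun q' hq' => hi _ ⟨q', hq', rfl⟩⟩
  choose F hF hmax using hex
  refine ⟨⟨F, fun g c => ?_⟩, fun c d hcd => ?_⟩
  · refine huniq (g • c) _ (hF _) _ (hSg g c _ (hF c)) (le_antisymm ?_ ?_)
    · have := hSg g⁻¹ _ _ (hF (g • c))
      rw [inv_smul_smul] at this
      exact hmax c (g⁻¹ • F (g • c)) this
    · exact hmax _ _ (hSg g c _ (hF c))
  -- `S` is monotone, so the top level cannot drop; if it stays the same, uniqueness on that level
  -- gives equality.
  · have hmem : F c ∈ S d := by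
      obtain ⟨x, hx, hq⟩ := hF c
      exact ⟨x, hmono hcd hx, hq⟩
    rcases (hmax d _ hmem).eq_or_lt with h | h
    · exact Or.inl (huniq d _ hmem _ (hF d) h)
    · exact Or.inr h

end Join

/-! ### Attainment and minimality of the mapping index -/

section Index

variable {G : Type v} [Group G]

theorem exists_map_of_mappingIndex_eq {X : Type*} [TopologicalSpace X] [MulAction G X]
    [ContinuousConstSMul G X] {n : ℕ} (h : mappingIndex G X = n) :
    ∃ f : X →[G] EG G n, Continuous f := by
  by_contra hn
  have : ((n + 1 : ℕ) : ℕ∞) ≤ mappingIndex G X := by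
    refine le_iInf₂ fun k hk => ?_
    have h1 : mappingIndex G X ≤ k := iInf₂_le k hk
    rw [h, Nat.cast_le] at h1
    rw [Nat.cast_le]
    exact h1.lt_of_ne fun e => hn (e ▸ hk)
  rw [h, Nat.cast_le] at this
  omega

theorem le_of_mappingIndex_eq {X : Type*} [TopologicalSpace X] [MulAction G X]
    [ContinuousConstSMul G X] {n k : ℕ} (h : mappingIndex G X = n) (f : X →[G] EG G k)
    (hf : Continuous f) : n ≤ k := by
  have h1 : mappingIndex G X ≤ k := iInf₂_le k ⟨f, hf⟩
  rwa [h, Nat.cast_le] at h1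

end Index

/-! ### From monotone maps of face posets to maps of realizations -/

namespace GComplex

variable {G : Type v} [Group G] {V : Type u} [MulAction G V]

theorem mem_smul_iff {K : GComplex G V} (g : G) (s : K.FacePoset) (v : V) :
    v ∈ (g • s).1 ↔ g⁻¹ • v ∈ s.1 := by
  change v ∈ s.1.map _ ↔ _
  simp only [Finset.mem_map_equiv]
  rfl

theorem smul_apply [Fintype V] {K : GComplex G V} (g : G) (x : K.Realization) (v : V) :
    (g • x).1 v = x.1 (g⁻¹ • v) := rfl

open Classical in
/-- A function that is positive exactly at the points whose coordinates on `s` are positive and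
exceed all other coordinates. -/
noncomputable def flagWeight [Fintype V] (s : Finset V) (x : V → ℝ) : ℝ :=
  ∏ v, if v ∈ s then x v * ∏ w, (if w ∈ s then 1 else max 0 (x v - x w)) else 1

theorem continuous_flagWeight [Fintype V] (s : Finset V) : Continuous (flagWeight s) := by
  classical
  refine continuous_finsetProd _ fun v _ => ?_
  split_ifs
  · refine (continuous_apply v).mul (continuous_finsetProd _ fun w _ => ?_)
    split_ifs
    · exact continuous_const
    · exact continuous_const.max ((continuous_apply v).sub (continuous_apply w))
  · exact continuous_const

theorem flagWeight_nonneg [Fintype V] (s : Finset V) {x : V → ℝ} (hx : ∀ v, 0 ≤ x v) :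
    0 ≤ flagWeight s x := by
  refine Finset.prod_nonneg fun v _ => ?_
  split_ifs
  · refine mul_nonneg (hx v) (Finset.prod_nonneg fun w _ => ?_)
    split_ifs
    · exact zero_le_one
    · exact le_max_left _ _
  · exact zero_le_one

theorem lt_of_flagWeight_ne_zero [Fintype V] {s : Finset V} {x : V → ℝ} (h : flagWeight s x ≠ 0)
    {v w : V} (hv : v ∈ s) (hw : w ∉ s) : x w < x v := by
  have h1 := Finset.prod_ne_zero_iff.1 h v (Finset.mem_univ v)
  rw [if_pos hv] at h1
  have h2 := Finset.prod_ne_zero_iff.1 (right_ne_zero_of_mul h1) w (Finset.mem_univ w)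
  rw [if_neg hw] at h2
  by_contra h3
  exact h2 (max_eq_left (sub_nonpos.2 (not_lt.1 h3)))

theorem flagWeight_ne_zero [Fintype V] {s : Finset V} {x : V → ℝ} (h0 : ∀ v ∈ s, x v ≠ 0)
    (h : ∀ v ∈ s, ∀ w ∉ s, x w < x v) : flagWeight s x ≠ 0 := by
  refine Finset.prod_ne_zero_iff.2 fun v _ => ?_
  split_ifs with hv
  · refine mul_ne_zero (h0 v hv) (Finset.prod_ne_zero_iff.2 fun w _ => ?_)
    split_ifs with hw
    · exact one_ne_zero
    · exact (lt_max_of_lt_right (sub_pos.2 (h v hv w hw))).ne'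
  · exact one_ne_zero

open Classical in
theorem flagWeight_smul [Fintype V] {K : GComplex G V} (g : G) (s : K.FacePoset)
    (x : K.Realization) : flagWeight (g • s).1 (g • x).1 = flagWeight s.1 x.1 := by
  have hs : ∀ v, g • v ∈ (g • s).1 ↔ v ∈ s.1 := fun v => by rw [mem_smul_iff, inv_smul_smul]
  have hx : ∀ v, (g • x).1 (g • v) = x.1 v := fun v => by rw [smul_apply, inv_smul_smul]
  unfold flagWeight
  rw [← Equiv.prod_comp (MulAction.toPerm g)]
  refine Finset.prod_congr rfl fun v _ => if_congr (hs v) (congrArg₂ _ (hx v) ?_) rfl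
  rw [← Equiv.prod_comp (MulAction.toPerm g)]
  refine Finset.prod_congr rfl fun w _ => if_congr (hs w) rfl ?_
  exact congrArg₂ (fun a b : ℝ => max 0 (a - b)) (hx v) (hx w)

theorem Realization.nonneg [Fintype V] {K : GComplex G V} (x : K.Realization) (v : V) :
    0 ≤ x.1 v := x.2.1.1 v

theorem mem_faces_of_support [Fintype V] {K : GComplex G V} (x : K.Realization) {s : Finset V}
    (hs : s.Nonempty) (h : ∀ v ∈ s, x.1 v ≠ 0) : s ∈ K.faces := by
  obtain ⟨t, ht, hx⟩ := x.2.2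
  refine (K.isRelLowerSet_faces ht).2 (fun v hv => ?_) hs
  by_contra hvt
  exact h v hv (hx v hvt)

theorem exists_flagWeight_ne_zero [Fintype V] {K : GComplex G V} (x : K.Realization) :
    ∃ s : K.FacePoset, flagWeight s.1 x.1 ≠ 0 := by
  classical
  have hne : Nonempty V := by
    by_contra h
    rw [not_nonempty_iff] at h
    have := x.2.1.2
    simp at this
  obtain ⟨m, hm⟩ := Finite.exists_max x.1
  have hm0 : x.1 m ≠ 0 := fun h0 => by
    have := x.2.1.2
    rw [Finset.sum_eq_zero fun v _ => le_antisymm ((hm v).trans_eq h0) (x.nonneg v)] at this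
    exact zero_ne_one this
  -- The vertices with maximal coordinate form a face of nonzero weight.
  let s : Finset V := {v | x.1 v = x.1 m}
  have hs : ∀ v, v ∈ s ↔ x.1 v = x.1 m := fun v => by simp [s]
  have h0 : ∀ v ∈ s, x.1 v ≠ 0 := fun v hv => by rwa [(hs v).1 hv]
  refine ⟨⟨s, mem_faces_of_support x ⟨m, (hs m).2 rfl⟩ h0⟩, flagWeight_ne_zero h0 ?_⟩
  intro v hv w hw
  rw [(hs v).1 hv]
  exact (hm w).lt_of_ne fun h => hw ((hs w).2 h)

theorem le_total_of_flagWeight_ne_zero [Fintype V] {K : GComplex G V} {s t : K.FacePoset}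
    {x : V → ℝ} (hs : flagWeight s.1 x ≠ 0) (ht : flagWeight t.1 x ≠ 0) : s ≤ t ∨ t ≤ s := by
  by_contra! h
  obtain ⟨v, hv, hv'⟩ := Finset.not_subset.1 h.1
  obtain ⟨w, hw, hw'⟩ := Finset.not_subset.1 h.2
  exact lt_asymm (lt_of_flagWeight_ne_zero hs hv hw') (lt_of_flagWeight_ne_zero ht hw hv')

/-- The faces of nonzero weight at a point form a chain. A monotone `F` takes at most one value per
level on a chain, so the weights summed over the fibres of `F` meet the uniqueness condition of the
join. -/
theorem exists_map_EG [Finite G] [Fintype V] (K : GComplex G V) {m : ℕ}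
    (F : K.FacePoset →[G] QPoset G m) (hF : Monotone F) :
    ∃ f : K.Realization →[G] EG G m, Continuous f := by
  classical
  have : Finite K.FacePoset := Subtype.finite
  have := Fintype.ofFinite K.FacePoset
  have hnn : ∀ g i (x : K.Realization) (s : K.FacePoset),
      0 ≤ if F s = ⟨g, i⟩ then flagWeight s.1 x.1 else 0 := fun g i x s => by
    split_ifs
    · exact flagWeight_nonneg _ x.nonneg
    · exact le_rfl
  have hex : ∀ g i (x : K.Realization),
      (∑ s : K.FacePoset, if F s = ⟨g, i⟩ then flagWeight s.1 x.1 else 0) ≠ 0 →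
        ∃ s, F s = ⟨g, i⟩ ∧ flagWeight s.1 x.1 ≠ 0 := fun g i x h => by
    obtain ⟨s, -, hs⟩ := Finset.exists_ne_zero_of_sum_ne_zero h
    exact ⟨s, (ite_ne_right_iff.1 hs)⟩
  refine exists_map_EG_of_weights
    (fun g i (x : K.Realization) => ∑ s : K.FacePoset,
      if F s = ⟨g, i⟩ then flagWeight s.1 x.1 else 0) ?_ ?_ ?_ ?_ ?_
  · refine fun g i => continuous_finsetSum _ fun s _ => ?_
    split_ifs
    · exact (continuous_flagWeight s.1).comp continuous_induced_dom
    · exact continuous_const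
  · exact fun g i x => Finset.sum_nonneg fun s _ => hnn g i x s
  · intro x
    obtain ⟨s, hs⟩ := exists_flagWeight_ne_zero x
    refine ⟨(F s).elt, (F s).level, (Finset.sum_pos' (fun t _ => hnn _ _ x t)
      ⟨s, Finset.mem_univ s, ?_⟩).ne'⟩
    rw [if_pos rfl]
    exact (flagWeight_nonneg _ x.nonneg).lt_of_ne' hs
  · intro g h i x hg hh
    obtain ⟨s, hs, hs'⟩ := hex g i x hg
    obtain ⟨t, ht, ht'⟩ := hex h i x hh
    have key : ∀ p q : QPoset G m, p ≤ q → p.level = q.level → p = q := by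
      rintro p q (h | h) hpq
      · exact h
      · exact absurd hpq h.ne
    have : F s = F t := by
      rcases le_total_of_flagWeight_ne_zero hs' ht' with h | h
      · exact key _ _ (hF h) (by rw [hs, ht])
      · exact (key _ _ (hF h) (by rw [hs, ht])).symm
    rw [hs, ht] at this
    exact congrArg QPoset.elt this
  · intro g h i x
    rw [← Equiv.sum_comp (MulAction.toPerm g)]
    refine Finset.sum_congr rfl fun s _ => ?_
    rw [MulAction.toPerm_apply, map_smul, flagWeight_smul]
    exact if_congr (smul_left_cancel_iff (α := G) (β := QPoset G m) g (x := F s) (y := ⟨h, i⟩))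
      rfl rfl

end GComplex

/-! ### Fine approximation by nerves of star covers -/

namespace GComplex

variable {G : Type v} [Group G] {V : Type u} [MulAction G V] [Fintype V]

theorem isCompact_setOf_realization (K : GComplex G V) :
    IsCompact {x : V → ℝ | x ∈ stdSimplex ℝ V ∧ ∃ s ∈ K.faces, ∀ v, v ∉ s → x v = 0} := by
  refine (isCompact_stdSimplex ℝ V).inter_right ?_
  have : {x : V → ℝ | ∃ s ∈ K.faces, ∀ v, v ∉ s → x v = 0} =
      ⋃ s ∈ K.faces, ⋂ v, ⋂ (_ : v ∉ s), {x : V → ℝ | x v = 0} := by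
    ext x
    simp
  change IsClosed {x : V → ℝ | ∃ s ∈ K.faces, ∀ v, v ∉ s → x v = 0}
  rw [this]
  refine Set.Finite.isClosed_biUnion (Set.toFinite _) fun s _ => ?_
  exact isClosed_iInter fun v => isClosed_iInter fun _ =>
    isClosed_eq (continuous_apply v) continuous_const

instance (K : GComplex G V) : CompactSpace K.Realization :=
  isCompact_iff_compactSpace.1 K.isCompact_setOf_realization

open Classical in
/-- A function of `x` that is positive exactly on the part of the open `ε`-ball around `p` that lies
in the open star of the smallest face containing `p`. -/
noncomputable def starWeight (ε : ℝ) (p x : V → ℝ) : ℝ :=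
  (∏ v, if p v = 0 then 1 else x v) * max 0 (ε - dist x p)

theorem continuous_starWeight (ε : ℝ) (p : V → ℝ) : Continuous (starWeight ε p) := by
  classical
  refine (continuous_finsetProd _ fun v _ => ?_).mul
    (continuous_const.max (continuous_const.sub (continuous_id.dist continuous_const)))
  split_ifs
  · exact continuous_const
  · exact continuous_apply v

theorem starWeight_nonneg (ε : ℝ) (p : V → ℝ) {x : V → ℝ} (hx : ∀ v, 0 ≤ x v) :
    0 ≤ starWeight ε p x := by
  refine mul_nonneg (Finset.prod_nonneg fun v _ => ?_) (le_max_left _ _)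
  split_ifs
  · exact zero_le_one
  · exact hx v

theorem starWeight_self_ne_zero {ε : ℝ} (hε : 0 < ε) (p : V → ℝ) : starWeight ε p p ≠ 0 := by
  refine mul_ne_zero (Finset.prod_ne_zero_iff.2 fun v _ => ?_) ?_
  · split_ifs with h
    · exact one_ne_zero
    · exact h
  · rw [dist_self, sub_zero, max_eq_right hε.le]
    exact hε.ne'

theorem dist_lt_of_starWeight_ne_zero {ε : ℝ} {p x : V → ℝ} (h : starWeight ε p x ≠ 0) :
    dist p x < ε := by
  have h1 := right_ne_zero_of_mul h
  rw [dist_comm]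
  by_contra h2
  exact h1 (max_eq_left (sub_nonpos.2 (not_lt.1 h2)))

theorem apply_eq_zero_of_starWeight_ne_zero {ε : ℝ} {p x : V → ℝ} (h : starWeight ε p x ≠ 0)
    {v : V} (hv : x v = 0) : p v = 0 := by
  have h1 := Finset.prod_ne_zero_iff.1 (left_ne_zero_of_mul h) v (Finset.mem_univ v)
  by_contra h2
  rw [if_neg h2] at h1
  exact h1 hv

theorem dist_smul_smul {K : GComplex G V} (g : G) (x y : K.Realization) :
    dist (g • x).1 (g • y).1 = dist x.1 y.1 := by
  have key : ∀ (g : G) (x y : K.Realization), dist (g • x).1 (g • y).1 ≤ dist x.1 y.1 :=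
    fun g x y => (dist_pi_le_iff dist_nonneg).2 fun v => dist_le_pi_dist x.1 y.1 (g⁻¹ • v)
  refine le_antisymm (key g x y) ?_
  have := key g⁻¹ (g • x) (g • y)
  rwa [inv_smul_smul, inv_smul_smul] at this

open Classical in
theorem starWeight_smul {K : GComplex G V} (ε : ℝ) (g : G) (p x : K.Realization) :
    starWeight ε (g • p).1 (g • x).1 = starWeight ε p.1 x.1 := by
  have hx : ∀ (x : K.Realization) v, (g • x).1 (g • v) = x.1 v := fun x v => by
    rw [smul_apply, inv_smul_smul]
  unfold starWeight
  rw [dist_smul_smul, ← Equiv.prod_comp (MulAction.toPerm g)]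
  refine congrArg (· * _) (Finset.prod_congr rfl fun v _ => ?_)
  exact if_congr (by rw [MulAction.toPerm_apply, hx]) rfl (hx x v)

/-- Compactness gives finitely many centres; adding their translates keeps the set finite because
`G` is finite. -/
theorem exists_finite_cover [Finite G] (K : GComplex G V) {ε : ℝ} (hε : 0 < ε) :
    ∃ T : Set K.Realization, T.Finite ∧ (∀ (g : G), ∀ p ∈ T, g • p ∈ T) ∧
      ∀ x : K.Realization, ∃ p ∈ T, starWeight ε p.1 x.1 ≠ 0 := by
  obtain ⟨T, hT⟩ := (isCompact_univ (X := K.Realization)).elim_finite_subcover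
    (fun p : K.Realization => {x : K.Realization | starWeight ε p.1 x.1 ≠ 0})
    (fun p => isOpen_ne_fun ((continuous_starWeight ε p.1).comp continuous_induced_dom)
      continuous_const)
    (fun x _ => Set.mem_iUnion.2 ⟨x, starWeight_self_ne_zero hε x.1⟩)
  refine ⟨⋃ g : G, (g • ·) '' (T : Set K.Realization),
    Set.finite_iUnion fun g => T.finite_toSet.image _, ?_, fun x => ?_⟩
  · intro g p hp
    obtain ⟨h, q, hq, rfl⟩ := Set.mem_iUnion.1 hp
    exact Set.mem_iUnion.2 ⟨g * h, q, hq, mul_smul g h q⟩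
  · obtain ⟨p, hp, hpx⟩ := Set.mem_iUnion₂.1 (hT (Set.mem_univ x))
    exact ⟨p, Set.mem_iUnion.2 ⟨1, p, hp, one_smul G p⟩, hpx⟩

/-- A finite `G`-stable set of points of a realization, as a type with `G`-action. -/
abbrev pointsMulAction {K : GComplex G V} (T : Set K.Realization)
    (hT : ∀ (g : G), ∀ p ∈ T, g • p ∈ T) : MulAction G T where
  smul g p := ⟨g • p.1, hT g p.1 p.2⟩
  one_smul p := Subtype.ext (one_smul G p.1)
  mul_smul g h p := Subtype.ext (mul_smul g h p.1)

/-- The nerve of the cover of the realization by the stars of radius `ε` around the points of a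
`G`-stable set. -/
def starNerve (K : GComplex G V) {ε : ℝ} (hε : 0 < ε) (T : Set K.Realization)
    (hT : ∀ (g : G), ∀ p ∈ T, g • p ∈ T) :
    letI := pointsMulAction T hT
    GComplex G T :=
  letI := pointsMulAction T hT
  { faces := {s | s.Nonempty ∧ ∃ x : K.Realization, ∀ p ∈ s, starWeight ε p.1.1 x.1 ≠ 0}
    isRelLowerSet_faces := fun s hs => ⟨hs.1, fun t hts ht =>
      ⟨ht, hs.2.imp fun x hx p hp => hx p (hts hp)⟩⟩
    singleton_mem := fun p => ⟨Finset.singleton_nonempty p, p.1, fun q hq => by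
      rw [Finset.mem_singleton.1 hq]
      exact starWeight_self_ne_zero hε p.1.1⟩
    smul_mem := by
      rintro g s ⟨hs, x, hx⟩
      refine ⟨hs.map, g • x, fun p hp => ?_⟩
      obtain ⟨q, hq, rfl⟩ := Finset.mem_map.1 hp
      exact (starWeight_smul ε g q.1 x).trans_ne (hx q hq) }

/-- Every finite `G`-complex has equivariant maps to and from a finite `G`-complex whose faces are
mapped to sets of small diameter. -/
theorem exists_fine_complex [Finite G] (K : GComplex G V) {ε : ℝ} (hε : 0 < ε) :
    ∃ (W : Type u) (_ : Fintype W) (_ : MulAction G W) (L : GComplex G W)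
      (r : K.Realization →[G] L.Realization) (π : L.Realization →[G] K.Realization),
      Continuous r ∧ ∀ s ∈ L.faces, ∀ x y : L.Realization, (∀ p ∉ s, x.1 p = 0) →
        (∀ p ∉ s, y.1 p = 0) → dist (π x).1 (π y).1 < ε := by
  classical
  obtain ⟨T, hfin, hT, hcov⟩ := K.exists_finite_cover (half_pos hε)
  let : Fintype T := hfin.fintype
  let : MulAction G T := pointsMulAction T hT
  let L : GComplex G T := K.starNerve (half_pos hε) T hT
  let S : K.Realization → ℝ := fun x => ∑ p : T, starWeight (ε / 2) p.1.1 x.1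
  have hS : ∀ x, 0 < S x := fun x => by
    obtain ⟨p, hp, h⟩ := hcov x
    exact Finset.sum_pos' (fun p _ => starWeight_nonneg _ _ x.nonneg)
      ⟨⟨p, hp⟩, Finset.mem_univ _, (starWeight_nonneg _ _ x.nonneg).lt_of_ne' h⟩
  have hSg : ∀ (g : G) x, S (g • x) = S x := fun g x => by
    change ∑ p : T, _ = _
    rw [← Equiv.sum_comp (MulAction.toPerm g)]
    exact Finset.sum_congr rfl fun p _ => starWeight_smul _ g p.1 x
  -- The partition of unity given by the normalized star weights.
  let r : K.Realization → L.Realization := fun x =>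
    ⟨fun p => starWeight (ε / 2) p.1.1 x.1 / S x,
      ⟨fun p => div_nonneg (starWeight_nonneg _ _ x.nonneg) (hS x).le, by
        rw [← Finset.sum_div]
        exact div_self (hS x).ne'⟩,
      ({p | starWeight (ε / 2) p.1.1 x.1 ≠ 0} : Finset T), by
        obtain ⟨p, hp, h⟩ := hcov x
        exact ⟨⟨⟨p, hp⟩, by simpa using h⟩, x, fun p hp => by simpa using hp⟩,
      fun p hp => by
        have : starWeight (ε / 2) p.1.1 x.1 = 0 := by simpa using hp
        exact (congrArg (· / S x) this).trans (zero_div _)⟩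
  have hr : ∀ (g : G) x, r (g • x) = g • r x := fun g x => by
    refine Subtype.ext (funext fun p => ?_)
    change starWeight (ε / 2) p.1.1 (g • x).1 / S (g • x) =
      starWeight (ε / 2) (g⁻¹ • p.1).1 x.1 / S x
    rw [hSg, ← starWeight_smul _ g (g⁻¹ • p.1) x, smul_inv_smul]
  -- The affine extension of the map sending each vertex of the nerve to the point that it names.
  let π' : L.Realization → V → ℝ := fun x => ∑ p : T, x.1 p • p.1.1
  have hmem : ∀ (C : Set (V → ℝ)), Convex ℝ C → ∀ (s : Finset T) (x : L.Realization),
      (∀ p ∉ s, x.1 p = 0) → (∀ p ∈ s, p.1.1 ∈ C) → π' x ∈ C := fun C hC s x hx hs => by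
    have h1 : π' x = ∑ p ∈ s, x.1 p • p.1.1 := by
      refine (Finset.sum_subset (Finset.subset_univ s) fun p _ hp => ?_).symm
      rw [hx p hp, zero_smul]
    have h2 : ∑ p ∈ s, x.1 p = 1 := by
      rw [← x.2.1.2]
      exact Finset.sum_subset (Finset.subset_univ s) fun p _ hp => hx p hp
    rw [h1]
    exact hC.sum_mem (fun p _ => x.2.1.1 p) h2 hs
  let π : L.Realization → K.Realization := fun x => ⟨π' x, by
    obtain ⟨s, ⟨-, z, hz⟩, hx⟩ := x.2.2
    refine ⟨hmem _ (convex_stdSimplex ℝ V) s x hx fun p _ => p.1.2.1, ?_⟩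
    -- A common point `z` of the stars lies in some face `t`. Nonzero star weight at `z` puts the
    -- support of each centre inside that of `z`, so the convex combination stays in `t`.
    obtain ⟨t, ht, hzt⟩ := z.2.2
    refine ⟨t, ht, fun v hv => ?_⟩
    have h0 : ∀ p : T, x.1 p * p.1.1 v = 0 := fun p => by
      by_cases hp : p ∈ s
      · rw [apply_eq_zero_of_starWeight_ne_zero (hz p hp) (hzt v hv), mul_zero]
      · rw [hx p hp, zero_mul]
    simp [π', Finset.sum_apply, h0]⟩
  have hπ : ∀ (g : G) x, π (g • x) = g • π x := fun g x => by
    refine Subtype.ext (funext fun v => ?_)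
    change (∑ p : T, (g • x).1 p • p.1.1) v = (∑ p : T, x.1 p • p.1.1) (g⁻¹ • v)
    rw [← Equiv.sum_comp (MulAction.toPerm g), Finset.sum_apply, Finset.sum_apply]
    refine Finset.sum_congr rfl fun p _ => ?_
    rw [MulAction.toPerm_apply, Pi.smul_apply, Pi.smul_apply, smul_apply, inv_smul_smul]
    rfl
  refine ⟨T, inferInstance, inferInstance, L, ⟨r, hr⟩, ⟨π, hπ⟩, ?_, ?_⟩
  · refine continuous_induced_rng.2 (continuous_pi fun p => ?_)
    exact Continuous.div ((continuous_starWeight _ _).comp continuous_induced_dom)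
      (continuous_finsetSum _ fun p _ => (continuous_starWeight _ _).comp continuous_induced_dom)
      fun x => (hS x).ne'
  · rintro s ⟨-, z, hz⟩ x y hx hy
    -- All centres in `s` lie in the convex ball of radius `ε / 2` about `z`, so the image of the
    -- cell does too.
    have key : ∀ x : L.Realization, (∀ p ∉ s, x.1 p = 0) → dist (π x).1 z.1 < ε / 2 :=
      fun x hx => hmem (Metric.ball z.1 (ε / 2)) (convex_ball _ _) s x hx fun p hp =>
        dist_lt_of_starWeight_ne_zero (hz p hp)
    calc dist (π x).1 (π y).1 ≤ dist (π x).1 z.1 + dist (π y).1 z.1 := dist_triangle_right _ _ _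
      _ < ε / 2 + ε / 2 := add_lt_add (key x hx) (key y hy)
      _ = ε := add_halves ε

end GComplex

/-! ### Closed cells, freeness and uniform continuity -/

namespace GComplex

variable {G : Type v} [Group G] {V : Type u} [MulAction G V] [Fintype V]

/-- The points of the realization lying in the closed face `s`. -/
def cell {K : GComplex G V} (s : K.FacePoset) : Set K.Realization :=
  {x | ∀ v ∉ s.1, x.1 v = 0}

theorem cell_mono {K : GComplex G V} : Monotone (cell : K.FacePoset → _) :=
  fun _ _ hst _ hx v hv => hx v fun h => hv (hst h)

theorem smul_mem_cell {K : GComplex G V} (g : G) {s : K.FacePoset} {x : K.Realization}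
    (hx : x ∈ cell s) : g • x ∈ cell (g • s) := fun v hv => by
  rw [smul_apply]
  exact hx _ fun h => hv ((mem_smul_iff g s v).2 h)

theorem cell_nonempty {K : GComplex G V} (s : K.FacePoset) : (cell s).Nonempty := by
  classical
  obtain ⟨v, hv⟩ := (K.isRelLowerSet_faces s.2).1
  have h0 : ∀ w ∉ s.1, (Pi.single v 1 : V → ℝ) w = 0 := fun w hw =>
    Pi.single_eq_of_ne (by rintro rfl; exact hw hv) 1
  exact ⟨⟨Pi.single v 1, single_mem_stdSimplex ℝ v, s.1, s.2, h0⟩, h0⟩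

/-- A coincidence `g • x = h • x` is carried by `π` to one in the free space. -/
theorem isFree_of_map {W : Type u} [MulAction G W] [Fintype W] {K : GComplex G V}
    {L : GComplex G W} (hK : K.IsFree) (π : L.Realization →[G] K.Realization) : L.IsFree where
  left_cancel' g _ _ h := smul_left_cancel g h
  right_cancel' g h x hgh := hK.right_cancel' g h (π x) (by rw [← map_smul, ← map_smul, hgh])


end GComplex

/-- An equivariant map from a product of realizations to a join varies little on pairs of sets of
small diameter. -/
theorem exists_dist_coord_lt {G : Type v} [Group G] [Finite G] {V₁ V₂ : Type u} [Fintype V₁]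
    [Fintype V₂] [MulAction G V₁] [MulAction G V₂] {K₁ : GComplex G V₁} {K₂ : GComplex G V₂}
    {k : ℕ} {f : K₁.Realization × K₂.Realization → EG G k} (hf : Continuous f) :
    ∃ ε > 0, ∀ x y : K₁.Realization × K₂.Realization, dist x.1.1 y.1.1 < ε →
      dist x.2.1 y.2.1 < ε → ∀ g i,
        |(f x).coord g i - (f y).coord g i| < 1 / ((k : ℝ) + 1) := by
  have := Fintype.ofFinite G
  have hc : Continuous fun x => (f x).coord := EG.continuous_coord.comp hf
  -- `Realization` carries only a topology; uniform continuity is read on the underlying subtypes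
  -- with their sup metrics.
  have := isCompact_iff_compactSpace.1 K₁.isCompact_setOf_realization
  have := isCompact_iff_compactSpace.1 K₂.isCompact_setOf_realization
  obtain ⟨ε, hε, h⟩ := Metric.uniformContinuous_iff.1
    (CompactSpace.uniformContinuous_of_continuous (α :=
      {x : V₁ → ℝ | x ∈ stdSimplex ℝ V₁ ∧ ∃ s ∈ K₁.faces, ∀ v, v ∉ s → x v = 0} ×
      {x : V₂ → ℝ | x ∈ stdSimplex ℝ V₂ ∧ ∃ s ∈ K₂.faces, ∀ v, v ∉ s → x v = 0}) hc)
    (1 / ((k : ℝ) + 1)) (by positivity)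
  refine ⟨ε, hε, fun x y h1 h2 g i => ?_⟩
  have h3 := h (a := x) (b := y) (max_lt h1 h2)
  rw [← Real.dist_eq]
  exact ((dist_le_pi_dist _ _ i).trans (dist_le_pi_dist (f x).coord (f y).coord g)).trans_lt h3

/-! ### Comparison of the two indices and the theorem -/

namespace GComplex

variable {G : Type v} [Group G] [Finite G]

/-- A finite free `G`-complex of mapping index `n` is approximated by finite free `G`-complexes
whose face posets have cross-index `n`. -/
theorem exists_fine_complex_crossIndex {V : Type u} [MulAction G V] [Fintype V] {K : GComplex G V}
    (hK : K.IsFree) {n : ℕ} (hn : mappingIndex G K.Realization = n) {ε : ℝ} (hε : 0 < ε) :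
    ∃ (W : Type u) (_ : Fintype W) (_ : MulAction G W) (L : GComplex G W)
      (π : L.Realization →[G] K.Realization), L.IsFree ∧ crossIndex G L.FacePoset = n ∧
      ∀ s : L.FacePoset, ∀ x ∈ cell s, ∀ y ∈ cell s, dist (π x).1 (π y).1 < ε := by
  obtain ⟨f, hf⟩ := exists_map_of_mappingIndex_eq hn
  obtain ⟨δ, hδ, hs⟩ := exists_dist_coord_lt (K₁ := K) (K₂ := K) (hf.comp continuous_fst)
  -- Scale `δ` controls `f` and gives cross-index at most `n`; scale `ε` is the one asked for.
  obtain ⟨W, _, _, L, r, π, hr, hL⟩ := K.exists_fine_complex (lt_min hδ hε)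
  refine ⟨W, inferInstance, inferInstance, L, π, isFree_of_map hK π, le_antisymm
    (iInf₂_le n (exists_map_QPoset_of_small (f.comp π) cell cell_nonempty cell_mono
      (fun g _ _ => smul_mem_cell g) fun s x hx y hy => ?_)) (le_iInf₂ fun m => ?_),
    fun s x hx y hy => (hL s.1 s.2 x y hx hy).trans_le (min_le_right _ _)⟩
  · have hd := (hL s.1 s.2 x y hx hy).trans_le (min_le_left _ _)
    exact hs (π x, π x) (π y, π y) hd hd
  -- A map to `Q_m G` gives `|L| → E_m G`; composing with `r` yields a map on `K`, so `n ≤ m`.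
  · rintro ⟨F, hF⟩
    obtain ⟨e, he⟩ := L.exists_map_EG F hF
    exact Nat.cast_le.2 (le_of_mappingIndex_eq hn (e.comp r) (he.comp hr))

end GComplex

open GComplex in
theorem HCX.hct {G : Type v} [Group G] [Finite G] {n : ℕ} (h : HCX.{u, v} G n) :
    HCT.{u, v} G n := by
  intro V₁ V₂ _ _ _ _ K₁ K₂ hK₁ hK₂ h₁ h₂
  obtain ⟨f₁, hf₁⟩ := exists_map_of_mappingIndex_eq h₁
  refine le_antisymm (iInf₂_le n
    ⟨⟨fun x => f₁ x.1, fun g x => map_smul f₁ g x.1⟩, hf₁.comp continuous_fst⟩)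
    (le_iInf₂ fun k => ?_)
  rintro ⟨f, hf⟩
  obtain ⟨ε, hε, hs⟩ := exists_dist_coord_lt hf
  obtain ⟨W₁, _, _, L₁, π₁, hF₁, hx₁, hL₁⟩ := exists_fine_complex_crossIndex hK₁ h₁ hε
  obtain ⟨W₂, _, _, L₂, π₂, hF₂, hx₂, hL₂⟩ := exists_fine_complex_crossIndex hK₂ h₂ hε
  -- The hypothesis turns the goal `n ≤ k` into a bound on the cross-index of the product poset,
  -- which a single map to `Q_k G` settles.
  rw [← h W₁ W₂ L₁ L₂ hF₁ hF₂ hx₁ hx₂]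
  let π : L₁.Realization × L₂.Realization →[G] K₁.Realization × K₂.Realization :=
    ⟨fun x => (π₁ x.1, π₂ x.2), fun g x => Prod.ext (map_smul π₁ g x.1) (map_smul π₂ g x.2)⟩
  refine iInf₂_le k (exists_map_QPoset_of_small (f.comp π)
    (fun c : L₁.FacePoset × L₂.FacePoset => cell c.1 ×ˢ cell c.2)
    (fun c => (cell_nonempty c.1).prod (cell_nonempty c.2))
    (fun c d hcd => Set.prod_mono (cell_mono hcd.1) (cell_mono hcd.2))
    (fun g c x hx => ⟨smul_mem_cell g hx.1, smul_mem_cell g hx.2⟩) fun c x hx y hy => ?_)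
  exact hs (π x) (π y) (hL₁ c.1 x.1 hx.1 y.1 hy.1) (hL₂ c.2 x.2 hx.2 y.2 hy.2)

end EquivariantIndex

theorem theorem3 (G : Type v) [Group G] [Finite G] (n : ℕ)
    (h : EquivariantIndex.HCX.{u, v} G n) : EquivariantIndex.HCT.{u, v} G n := by
  exact h.hct
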